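/- **Theorem 1 (Inverse Standard Labeling).** Let $m \ge 0$ and let $S_m$ be the symmetric group on $m$ points, with composition of maps as product. Order $S_m$ by the Bruhat order: $u \le w$ if $u$ is the product of a subword of a reduced word for $w$, where a reduced word for $w$ is a word of minimal length in the adjacent transpositions $(i,\, i+1)$ with product $w$. Write $\sigma \lhd \tau$ for the covering relation of this order. Let $T$ be the set of all transpositions $(i,j)$, $i<j$, in $S_m$, ordered by the reverse of the dictionary order $$(i,j) \le_d (k,l) \iff i<k \text{ or } (i=k \text{ and } j \le l).$$ Then for every covering pair $\sigma \lhd \tau$ there is exactly one $t \in T$ with $\sigma = t\tau$, and the edge labeling $\lambda(\sigma,\tau) = t$, with values in $T$ under the reverse dictionary order, is an EL-labeling. That is, for all $x<y$ in $S_m$: 1. there is exactly one saturated chain $x = c_0 \lhd c_1 \lhd \dots \lhd c_k = y$ whose sequence of labels $\lambda(c_0,c_1), \dots, \lambda(c_{k-1},c_k)$ is non-decreasing; 2. for any two distinct saturated chains from $x$ to $y$, the label sequence of one of them is strictly smaller than that of the other in the dictionary order on sequences, and the label sequence of the chain in (1) is strictly smaller than that of every other saturated chain from $x$ to $y$. 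-/

import Mathlib

/-! ### Edge labelings of partially ordered sets -/

/-- A saturated chain `x = c₀ ⋖ c₁ ⋖ ⋯ ⋖ cₖ = y`. -/
inductive SaturatedChain {P : Type*} [LT P] : P → P → Type _
  | nil (x : P) : SaturatedChain x x
  | cons {x y z : P} (h : x ⋖ y) (c : SaturatedChain y z) : SaturatedChain x z

/-- An edge labeling: a function on the set of all pairs `(x, y)` with `x ⋖ y`, with values
in `Q`. -/
abbrev EdgeLabeling (P : Type*) [LT P] (Q : Type*) := ∀ x y : P, x ⋖ y → Q

/-- The word of labels of a saturated chain, read from the bottom to the top. -/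
def SaturatedChain.labels {P Q : Type*} [LT P] (lam : EdgeLabeling P Q) :
    {x y : P} → SaturatedChain x y → List Q
  | _, _, .nil _ => []
  | _, _, .cons h c => lam _ _ h :: c.labels lam

/-- The labels of the chain are non-decreasing from the bottom to the top. -/
def SaturatedChain.IsRising {P Q : Type*} [LT P] [LinearOrder Q] (lam : EdgeLabeling P Q)
    {x y : P} (c : SaturatedChain x y) : Prop :=
  (c.labels lam).Pairwise (· ≤ ·)

/-- The label word of `c` is strictly smaller than the label word of `d` in the dictionary
order. -/
def SaturatedChain.LexLT {P Q : Type*} [LT P] [LinearOrder Q] (lam : EdgeLabeling P Q)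
    {x y : P} (c d : SaturatedChain x y) : Prop :=
  List.Lex (· < ·) (c.labels lam) (d.labels lam)

/-- EL-labelings (edge lexicographic labelings). -/
structure IsELLabeling {P Q : Type*} [LT P] [LinearOrder Q] (lam : EdgeLabeling P Q) :
    Prop where
  /-- Between `x < y` there is exactly one saturated chain with non-decreasing labels. -/
  existsUnique_rising : ∀ x y : P, x < y → ∃! c : SaturatedChain x y, c.IsRising lam
  /-- Of any two distinct saturated chains from `x` to `y`, one has the smaller label word. -/
  lex_total : ∀ x y : P, x < y → ∀ c d : SaturatedChain x y, c ≠ d →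
    c.LexLT lam d ∨ d.LexLT lam c
  /-- The label word of the chain with non-decreasing labels is smaller than the label word
  of every other saturated chain from `x` to `y`. -/
  rising_minimal : ∀ x y : P, x < y → ∀ c d : SaturatedChain x y, c.IsRising lam → d ≠ c →
    c.LexLT lam d

/-! ### The Bruhat order on the symmetric group -/

/-- `s` is an adjacent transposition `(i, i + 1)`. -/
def IsAdjacentTransposition {m : ℕ} (s : Equiv.Perm (Fin m)) : Prop :=
  ∃ i j : Fin m, (i : ℕ) + 1 = j ∧ s = Equiv.swap i j

/-- `ω` is a word in the adjacent transpositions with product `w`. -/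
def IsWordFor {m : ℕ} (ω : List (Equiv.Perm (Fin m))) (w : Equiv.Perm (Fin m)) : Prop :=
  (∀ s ∈ ω, IsAdjacentTransposition s) ∧ ω.prod = w

/-- `ω` is a word of minimal length, that is a reduced word, for `w`. -/
def IsReducedWordFor {m : ℕ} (ω : List (Equiv.Perm (Fin m))) (w : Equiv.Perm (Fin m)) : Prop :=
  IsWordFor ω w ∧ ∀ ω' : List (Equiv.Perm (Fin m)), IsWordFor ω' w → ω.length ≤ ω'.length

/-- The Bruhat order: `u ≤ w` if `u` is the product of a subword of a reduced word for `w`. -/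
def BruhatLE {m : ℕ} (u w : Equiv.Perm (Fin m)) : Prop :=
  ∃ ω : List (Equiv.Perm (Fin m)), IsReducedWordFor ω w ∧
    ∃ ω' : List (Equiv.Perm (Fin m)), ω'.Sublist ω ∧ ω'.prod = u

/-- The strict Bruhat order. With this instance, `σ ⋖ τ` is the covering relation of the
Bruhat order. -/
instance bruhatLT (m : ℕ) : LT (Equiv.Perm (Fin m)) where
  lt u w := BruhatLE u w ∧ u ≠ w

/-! ### Reflections and the inverse standard labeling -/

/-- The reflections of the symmetric group: the transpositions `(i, j)`, written with
`i < j`. -/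
@[ext] structure Transposition (m : ℕ) where
  /-- the smaller of the two exchanged points -/
  i : Fin m
  /-- the larger of the two exchanged points -/
  j : Fin m
  lt : i < j

/-- The permutation that exchanges `i` and `j`. -/
def Transposition.toPerm {m : ℕ} (t : Transposition m) : Equiv.Perm (Fin m) :=
  Equiv.swap t.i t.j

theorem Transposition.toLex_injective (m : ℕ) :
    Function.Injective fun t : Transposition m => toLex (t.i, t.j) := by
  intro s t h
  have h2 : (s.i, s.j) = (t.i, t.j) := toLex.injective h
  exact Transposition.ext (congrArg Prod.fst h2) (congrArg Prod.snd h2)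

/-- The dictionary order on transpositions:
`(i, j) ≤ (k, l)` if and only if `i < k`, or `i = k` and `j ≤ l`. -/
instance Transposition.instLinearOrder (m : ℕ) : LinearOrder (Transposition m) :=
  LinearOrder.lift' (fun t : Transposition m => toLex (t.i, t.j))
    (Transposition.toLex_injective m)

/-- The condition that defines the inverse standard labeling: `σ ⋖ τ` is labeled by the
transposition `t` with `σ = t τ`. The labels are ordered by the reverse (order dual) of the
dictionary order. -/
def IsInverseStandardLabeling {m : ℕ}
    (lam : EdgeLabeling (Equiv.Perm (Fin m)) (Transposition m)ᵒᵈ) : Prop :=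
  ∀ (σ τ : Equiv.Perm (Fin m)) (h : σ ⋖ τ), σ = (OrderDual.ofDual (lam σ τ h)).toPerm * τ

/-! Passing to inverses turns `σ = t τ` into `σ⁻¹ = τ⁻¹ t`: a label `(i, j)` names the two positions
of `τ⁻¹` that are exchanged. The Bruhat order becomes the comparison of prefix counts of inverses
(`bruhatLE_iff`), and the covers below `τ` are the tight inversions of `τ⁻¹`.

For `x < y`, let `i` be the first position where `x⁻¹` and `y⁻¹` differ, and `j` the first later
position with `x⁻¹ i ≤ y⁻¹ j < y⁻¹ i`. Exchanging these two goes down from `y` and stays above `x`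
(`PrefixLE.exists_swap`). Repeated from the top, this greedy choice gives labels that never decrease
in the dictionary order; read upwards in the reverse order they form a rising chain
(`exists_rising`). Conversely, the top label of every rising chain is the greedy one (`last_eq`),
whence uniqueness.

Minimality reduces to rank two (`lexLT_of_rank_two`). There a failure would give two nested
factorizations of one permutation into two transpositions, which `Transposition.not_nested`
excludes. -/

open Equiv

/-! ### The rank matrix order -/

/-- The number of positions before `p` at which `f` takes a value at least `q`. -/
def prefixCount {m : ℕ} (f : Perm (Fin m)) (p : ℕ) (q : Fin m) : ℕ :=
  ∑ k : Fin m, if (k : ℕ) < p ∧ q ≤ f k then 1 else 0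

/-- Comparison of all prefix counts. -/
def PrefixLE {m : ℕ} (f g : Perm (Fin m)) : Prop :=
  ∀ p q, prefixCount f p q ≤ prefixCount g p q

theorem PrefixLE.refl {m : ℕ} (f : Perm (Fin m)) : PrefixLE f f := fun _ _ => le_rfl

theorem PrefixLE.trans {m : ℕ} {f g h : Perm (Fin m)} (h₁ : PrefixLE f g) (h₂ : PrefixLE g h) :
    PrefixLE f h := fun p q => (h₁ p q).trans (h₂ p q)

theorem prefixCount_succ {m : ℕ} (f : Perm (Fin m)) (a q : Fin m) :
    prefixCount f (a + 1) q = prefixCount f a q + if q ≤ f a then 1 else 0 := by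
  unfold prefixCount
  rw [← Finset.sum_erase_add _ _ (Finset.mem_univ a),
    ← Finset.sum_erase_add _ (fun k : Fin m => if (k : ℕ) < a ∧ q ≤ f k then 1 else 0)
      (Finset.mem_univ a)]
  simp only [lt_add_iff_pos_right, zero_lt_one, true_and, lt_irrefl, false_and, if_false, add_zero]
  congr 1
  refine Finset.sum_congr rfl fun k hk => ?_
  have : k ≠ a := Finset.ne_of_mem_erase hk
  have : (k : ℕ) ≠ a := fun h => this (Fin.ext h)
  have h : (k : ℕ) < a + 1 ↔ (k : ℕ) < a := by omega
  simp only [h]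

theorem prefixCount_congr {m : ℕ} {f g : Perm (Fin m)} {p : ℕ}
    (h : ∀ k : Fin m, (k : ℕ) < p → f k = g k) (q : Fin m) :
    prefixCount f p q = prefixCount g p q := by
  unfold prefixCount
  refine Finset.sum_congr rfl fun k _ => ?_
  by_cases hk : (k : ℕ) < p
  · rw [h k hk]
  · simp [hk]

theorem eq_of_prefixCount_eq {m : ℕ} {f g : Perm (Fin m)} {a : Fin m}
    (h₀ : ∀ q, prefixCount f a q = prefixCount g a q)
    (h₁ : ∀ q, prefixCount f (a + 1) q = prefixCount g (a + 1) q) : f a = g a := by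
  have key : ∀ q, q ≤ f a ↔ q ≤ g a := by
    intro q
    have := h₁ q
    rw [prefixCount_succ, prefixCount_succ, h₀ q] at this
    split_ifs at this with h h' h' <;> simp_all [not_le.2]
  exact le_antisymm ((key _).1 le_rfl) ((key _).2 le_rfl)

theorem PrefixLE.antisymm {m : ℕ} {f g : Perm (Fin m)} (h₁ : PrefixLE f g) (h₂ : PrefixLE g f) :
    f = g :=
  Equiv.ext fun _ => eq_of_prefixCount_eq (fun q => le_antisymm (h₁ _ q) (h₂ _ q))
    (fun q => le_antisymm (h₁ _ q) (h₂ _ q))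

/-- Permutations between `f` and `g` agree with them before the first position where `f` and `g`
differ. -/
theorem PrefixLE.agree {m : ℕ} {f h g : Perm (Fin m)} (h₁ : PrefixLE f h) (h₂ : PrefixLE h g)
    {i : Fin m} (hfg : ∀ k < i, f k = g k) : ∀ k < i, h k = f k := by
  have key : ∀ p : ℕ, p ≤ i → ∀ q, prefixCount h p q = prefixCount f p q := by
    intro p hp q
    have : prefixCount f p q = prefixCount g p q :=
      prefixCount_congr (fun k hk => hfg k (Fin.lt_def.2 (by omega))) q
    have := h₁ p q
    have := h₂ p q
    omega
  intro k hk
  have := Fin.lt_def.1 hk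
  exact eq_of_prefixCount_eq (key k (by omega)) (key (k + 1) (by omega))

theorem PrefixLE.apply_le {m : ℕ} {f g : Perm (Fin m)} (h : PrefixLE f g)
    {i : Fin m} (hfg : ∀ k < i, f k = g k) : f i ≤ g i := by
  have h₁ := h (i + 1) (f i)
  rw [prefixCount_succ, prefixCount_succ,
    prefixCount_congr (fun k hk => hfg k (Fin.lt_def.2 hk)) (f i)] at h₁
  by_contra hc
  simp [hc] at h₁

theorem prefixCount_mul_swap_of_le {m : ℕ} (g : Perm (Fin m)) {i j : Fin m} {p : ℕ} (q : Fin m)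
    (hi : p ≤ i) (hj : p ≤ j) : prefixCount (g * swap i j) p q = prefixCount g p q :=
  prefixCount_congr (fun k hk => by
    rw [Perm.mul_apply, swap_apply_of_ne_of_ne] <;> rintro rfl <;> omega) q

theorem prefixCount_mul_swap_of_lt {m : ℕ} (g : Perm (Fin m)) {i j : Fin m} {p : ℕ} (q : Fin m)
    (hi : i < p) (hj : j < p) : prefixCount (g * swap i j) p q = prefixCount g p q := by
  unfold prefixCount
  rw [← Equiv.sum_comp (swap i j) (fun k : Fin m => if (k : ℕ) < p ∧ q ≤ g k then 1 else 0)]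
  refine Finset.sum_congr rfl fun k _ => ?_
  have : ((swap i j k : Fin m) : ℕ) < p ↔ (k : ℕ) < p := by
    rw [swap_apply_def]
    split_ifs <;> simp_all
  exact if_congr (by rw [this, Perm.mul_apply]) rfl rfl

theorem prefixCount_mul_swap_of_mem {m : ℕ} (g : Perm (Fin m)) {i j : Fin m} {p : ℕ} (q : Fin m)
    (hi : i < p) (hj : p ≤ j) :
    prefixCount (g * swap i j) p q + (if q ≤ g i then 1 else 0) =
      prefixCount g p q + (if q ≤ g j then 1 else 0) := by
  unfold prefixCount
  rw [← Finset.sum_erase_add _ _ (Finset.mem_univ i),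
    ← Finset.sum_erase_add _ (fun k : Fin m => if (k : ℕ) < p ∧ q ≤ g k then 1 else 0)
      (Finset.mem_univ i)]
  have : ∑ k ∈ Finset.univ.erase i, (if (k : ℕ) < p ∧ q ≤ (g * swap i j) k then 1 else 0) =
      ∑ k ∈ Finset.univ.erase i, (if (k : ℕ) < p ∧ q ≤ g k then 1 else 0) := by
    refine Finset.sum_congr rfl fun k hk => ?_
    have hk := Finset.ne_of_mem_erase hk
    by_cases hkj : k = j
    · subst hkj
      simp [not_lt.2 hj]
    · rw [Perm.mul_apply, swap_apply_of_ne_of_ne hk hkj]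
  rw [this]
  simp only [hi, true_and, Perm.mul_apply, swap_apply_left]
  omega

/-- Undoing an inversion goes down. -/
theorem prefixLE_mul_swap {m : ℕ} {g : Perm (Fin m)} {i j : Fin m} (hij : i < j)
    (hg : g j < g i) : PrefixLE (g * swap i j) g := by
  intro p q
  have hij' := Fin.lt_def.1 hij
  rcases le_or_gt p i with hi | hi
  · rw [prefixCount_mul_swap_of_le g q hi (by omega)]
  rcases le_or_gt p j with hj | hj
  · have := prefixCount_mul_swap_of_mem g q hi hj
    by_cases h : q ≤ g j
    · simp only [h, h.trans hg.le, if_true] at this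
      omega
    · simp only [h, if_false] at this
      omega
  · rw [prefixCount_mul_swap_of_lt g q hi hj]

/-- Right multiplication by an adjacent transposition affects only one row of prefix counts. -/
theorem PrefixLE.of_adjacent {m : ℕ} {f g f' g' : Perm (Fin m)} (h : PrefixLE f g) {a b : Fin m}
    (hab : (a : ℕ) + 1 = b) (hf : f' = f ∨ f' = f * swap a b) (hg : g' = g ∨ g' = g * swap a b)
    (hrow : ∀ q, prefixCount f' b q ≤ prefixCount g' b q) : PrefixLE f' g' := by
  intro p q
  by_cases hp : p = b
  · exact hp ▸ hrow q
  have key : ∀ f f' : Perm (Fin m), (f' = f ∨ f' = f * swap a b) →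
      prefixCount f' p q = prefixCount f p q := by
    rintro f f' (rfl | rfl)
    · rfl
    rcases lt_or_gt_of_ne hp with hp | hp
    · exact prefixCount_mul_swap_of_le f q (by omega) (by omega)
    · exact prefixCount_mul_swap_of_lt f q (by omega) (by omega)
  rw [key f f' hf, key g g' hg]
  exact h p q

/-- Lifting property. In row `b`, the inequality in row `a` suffices unless `g b < q ≤ f a`. Then
`f` gains two between rows `a` and `b + 1` and `g` at most one, so row `b + 1` makes row `a` strict.
-/
theorem PrefixLE.le_mul_swap {m : ℕ} {f g : Perm (Fin m)} (h : PrefixLE f g) {a b : Fin m}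
    (hab : (a : ℕ) + 1 = b) (hg : g b < g a) (hf : f a < f b) : PrefixLE f (g * swap a b) := by
  refine h.of_adjacent hab (Or.inl rfl) (Or.inr rfl) fun q => ?_
  have h₀ := h a q
  have h₂ := h (b + 1) q
  have e := prefixCount_mul_swap_of_mem g (i := a) (j := b) (p := b) q (by omega) le_rfl
  have f₁ := prefixCount_succ f a q
  have f₂ := prefixCount_succ f b q
  have g₁ := prefixCount_succ g a q
  have g₂ := prefixCount_succ g b q
  rw [hab] at f₁ g₁
  have i₁ : q ≤ f a → q ≤ f b := fun h => h.trans hf.le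
  have i₂ : q ≤ g b → q ≤ g a := fun h => h.trans hg.le
  split_ifs at * <;> omega

/-- In row `b`, the inequality in row `a` suffices unless `g b < q ≤ f b`. Then `g` gains nothing
between rows `a` and `b + 1`, since also `g a < q`, while `f` gains at least one. -/
theorem PrefixLE.mul_swap_mul_swap {m : ℕ} {f g : Perm (Fin m)} (h : PrefixLE f g) {a b : Fin m}
    (hab : (a : ℕ) + 1 = b) (hg : g a < g b) : PrefixLE (f * swap a b) (g * swap a b) := by
  refine h.of_adjacent hab (Or.inr rfl) (Or.inr rfl) fun q => ?_
  have h₀ := h a q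
  have h₂ := h (b + 1) q
  have e := prefixCount_mul_swap_of_mem g (i := a) (j := b) (p := b) q (by omega) le_rfl
  have e' := prefixCount_mul_swap_of_mem f (i := a) (j := b) (p := b) q (by omega) le_rfl
  have f₁ := prefixCount_succ f a q
  have f₂ := prefixCount_succ f b q
  have g₁ := prefixCount_succ g a q
  have g₂ := prefixCount_succ g b q
  rw [hab] at f₁ g₁
  have i₂ : q ≤ g a → q ≤ g b := fun h => h.trans hg.le
  split_ifs at * <;> omega

/-- The smallest transposition, in the dictionary order, that leads from `g` down towards `f`. -/
theorem PrefixLE.exists_swap {m : ℕ} {f g : Perm (Fin m)} (h : PrefixLE f g) (hne : f ≠ g) :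
    ∃ i j : Fin m, i < j ∧ (∀ k < i, f k = g k) ∧ f i ≤ g j ∧ g j < g i ∧
      (∀ k, i < k → k < j → ¬ (f i ≤ g k ∧ g k < g i)) ∧ PrefixLE f (g * swap i j) := by
  have hex : ∃ i, f i ≠ g i := by
    by_contra! hc
    exact hne (Equiv.ext hc)
  obtain ⟨i, hi, hmin⟩ := exists_minimal_of_wellFoundedLT (fun i => f i ≠ g i) hex
  have hagree : ∀ k < i, f k = g k := by
    intro k hk
    by_contra hc
    exact absurd (hmin hc hk.le) (not_le.2 hk)
  have hlt : f i < g i := lt_of_le_of_ne (h.apply_le hagree) hi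
  have hex' : ∃ j, i < j ∧ f i ≤ g j ∧ g j < g i := by
    -- The position where `g` takes the value `f i` qualifies: it is not `i`, and not earlier, where
    -- `f` and `g` agree.
    refine ⟨g⁻¹ (f i), ?_, by simp, by simpa using hlt⟩
    rcases lt_trichotomy i (g⁻¹ (f i)) with h | h | h
    · exact h
    · exact absurd (by rw [Perm.eq_inv_iff_eq] at h; exact h.symm) hi
    · have := (hagree _ h).trans (Perm.eq_inv_iff_eq.1 rfl)
      exact absurd (f.injective this) h.ne
  obtain ⟨j, ⟨hij, hfj, hgj⟩, hminj⟩ :=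
    exists_minimal_of_wellFoundedLT (fun j => i < j ∧ f i ≤ g j ∧ g j < g i) hex'
  have hno : ∀ k, i < k → k < j → ¬ (f i ≤ g k ∧ g k < g i) := fun k hk hkj hc =>
    absurd (hminj ⟨hk, hc⟩ hkj.le) (not_le.2 hkj)
  refine ⟨i, j, hij, hagree, hfj, hgj, hno, fun p q => ?_⟩
  have hij' := Fin.lt_def.1 hij
  rcases le_or_gt p i with hip | hip
  · rw [prefixCount_mul_swap_of_le g q hip (by omega)]
    exact h p q
  rcases le_or_gt p j with hjp | hjp
  swap
  · rw [prefixCount_mul_swap_of_lt g q hip hjp]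
    exact h p q
  have e := prefixCount_mul_swap_of_mem g q hip hjp
  have hpq := h p q
  by_cases hq : q ≤ g j
  · simp only [hq, hq.trans hgj.le, if_true] at e
    omega
  by_cases hq' : q ≤ g i
  swap
  · simp only [hq, hq', if_false] at e
    omega
  simp only [hq, hq', if_false, if_true] at e
  -- Here the exchange costs `g` one, so strictness is needed. Lowering the threshold to `f i` adds
  -- equal amounts to both counts from positions before `i`. Beyond that `f` gains position `i`, but
  -- `g` gains nothing, as `q ≤ g i` and by the choice of `j`.
  suffices prefixCount f p q + 1 ≤ prefixCount g p q by omega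
  have hqf : f i < q := lt_of_le_of_lt hfj (not_le.1 hq)
  have hpf := h p (f i)
  unfold prefixCount at hpf ⊢
  -- compare the increments when the threshold drops from `q` to `f i`
  have hF : (∑ k : Fin m, if (k : ℕ) < p ∧ q ≤ f k then 1 else 0) + 1 +
      (∑ k : Fin m, if (k < i) ∧ f i ≤ f k ∧ f k < q then 1 else 0) ≤
      ∑ k : Fin m, if (k : ℕ) < p ∧ f i ≤ f k then 1 else 0 := by
    have h1 : (1 : ℕ) = ∑ k : Fin m, if k = i then 1 else 0 := by simp
    rw [h1, ← Finset.sum_add_distrib, ← Finset.sum_add_distrib]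
    refine Finset.sum_le_sum fun k _ => ?_
    by_cases hk : k = i
    · subst hk
      simp [hip, hqf]
    · grind
  have hG : (∑ k : Fin m, if (k : ℕ) < p ∧ f i ≤ g k then 1 else 0) =
      (∑ k : Fin m, if (k : ℕ) < p ∧ q ≤ g k then 1 else 0) +
      (∑ k : Fin m, if (k < i) ∧ f i ≤ g k ∧ g k < q then 1 else 0) := by
    rw [← Finset.sum_add_distrib]
    refine Finset.sum_congr rfl fun k _ => ?_
    rcases lt_trichotomy k i with hk | hk | hk
    · grind
    · grind
    · have := hno k hk
      grind
  have hE : (∑ k : Fin m, if (k < i) ∧ f i ≤ f k ∧ f k < q then 1 else 0) =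
      (∑ k : Fin m, if (k < i) ∧ f i ≤ g k ∧ g k < q then 1 else 0) := by
    refine Finset.sum_congr rfl fun k _ => ?_
    by_cases hk : k < i
    · rw [hagree k hk]
    · simp [hk]
  omega

/-! ### Words and the Bruhat order -/

theorem exists_isWordFor {m : ℕ} (w : Perm (Fin m)) : ∃ ω, IsWordFor ω w := by
  cases m with
  | zero => exact ⟨[], by simp, Subsingleton.elim _ _⟩
  | succ n =>
    have hw : w ∈ Submonoid.closure (Set.range fun i : Fin n ↦ swap i.castSucc i.succ) := by
      rw [Perm.mclosure_swap_castSucc_succ]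
      trivial
    obtain ⟨ω, hω, rfl⟩ := Submonoid.exists_list_of_mem_closure hw
    refine ⟨ω, fun s hs => ?_, rfl⟩
    obtain ⟨i, rfl⟩ := hω s hs
    exact ⟨i.castSucc, i.succ, by simp, rfl⟩

/-- The length of a permutation: the least length of a word for it. -/
noncomputable def wordLength {m : ℕ} (w : Perm (Fin m)) : ℕ :=
  sInf {n | ∃ ω, IsWordFor ω w ∧ ω.length = n}

theorem IsWordFor.wordLength_le {m : ℕ} {ω : List (Perm (Fin m))} {w : Perm (Fin m)}
    (h : IsWordFor ω w) : wordLength w ≤ ω.length :=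
  Nat.sInf_le ⟨ω, h, rfl⟩

theorem exists_isReducedWordFor {m : ℕ} (w : Perm (Fin m)) :
    ∃ ω, IsReducedWordFor ω w ∧ ω.length = wordLength w := by
  obtain ⟨ω₀, h₀⟩ := exists_isWordFor w
  obtain ⟨ω, hω, hl⟩ := Nat.sInf_mem (s := {n | ∃ ω, IsWordFor ω w ∧ ω.length = n}) ⟨_, ω₀, h₀, rfl⟩
  refine ⟨ω, ⟨hω, fun ω' h' => ?_⟩, hl⟩
  rw [hl]
  exact h'.wordLength_le

theorem IsReducedWordFor.length_eq {m : ℕ} {ω : List (Perm (Fin m))} {w : Perm (Fin m)}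
    (h : IsReducedWordFor ω w) : ω.length = wordLength w := by
  obtain ⟨ω', h', hl⟩ := exists_isReducedWordFor w
  exact le_antisymm (hl ▸ h.2 ω' h'.1) h.1.wordLength_le

theorem IsWordFor.cons {m : ℕ} {ω : List (Perm (Fin m))} {w s : Perm (Fin m)}
    (h : IsWordFor ω w) (hs : IsAdjacentTransposition s) : IsWordFor (s :: ω) (s * w) :=
  ⟨by simpa using ⟨hs, h.1⟩, by rw [List.prod_cons, h.2]⟩

theorem wordLength_swap_mul_le {m : ℕ} (w : Perm (Fin m)) {a b : Fin m} (hab : (a : ℕ) + 1 = b) :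
    wordLength (swap a b * w) ≤ wordLength w + 1 := by
  obtain ⟨ω, h, hl⟩ := exists_isReducedWordFor w
  have := (h.1.cons ⟨a, b, hab, rfl⟩).wordLength_le
  simpa [hl] using this

/-- The strong exchange property. -/
theorem IsWordFor.exchange {m : ℕ} {ω : List (Perm (Fin m))} {w : Perm (Fin m)}
    (h : IsWordFor ω w) {x y : Fin m} (hxy : x < y) (hw : w⁻¹ y < w⁻¹ x) :
    ∃ ω', IsWordFor ω' (swap x y * w) ∧ ω'.length + 1 = ω.length := by
  induction ω generalizing w x y with
  | nil =>
    obtain ⟨-, rfl⟩ := h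
    simp at hw
    exact absurd hxy hw.asymm
  | cons r ω ih =>
    obtain ⟨hω, rfl⟩ := h
    rw [List.prod_cons] at *
    obtain ⟨a, b, hab, rfl⟩ := hω r (by simp)
    have h₁ : IsWordFor ω ω.prod := ⟨fun s hs => hω s (by simp [hs]), rfl⟩
    by_cases heq : x = a ∧ y = b
    · obtain ⟨rfl, rfl⟩ := heq
      exact ⟨ω, by rwa [swap_mul_self_mul], rfl⟩
    -- An adjacent transposition reverses the order of no pair but its own, so the inversion passes
    -- to the tail of the word.
    have hlt : swap a b x < swap a b y := by
      have hab' : a < b := Fin.lt_def.2 (by omega)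
      rw [swap_apply_def, swap_apply_def]
      split_ifs <;> simp only [Fin.lt_def, Fin.ext_iff] at * <;> omega
    obtain ⟨ω', h', hl⟩ := ih h₁ hlt (by simpa [mul_inv_rev] using hw)
    refine ⟨swap a b :: ω', ?_, by simp [hl]⟩
    have := h'.cons ⟨a, b, hab, rfl⟩
    rwa [show swap a b * (swap (swap a b x) (swap a b y) * ω.prod) =
      swap x y * (swap a b * ω.prod) by
        rw [← mul_assoc, ← mul_assoc, mul_swap_eq_swap_mul, swap_apply_self, swap_apply_self]] at this

theorem wordLength_lt_of_inversion {m : ℕ} {w : Perm (Fin m)} {x y : Fin m} (hxy : x < y)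
    (hw : w⁻¹ y < w⁻¹ x) : wordLength (swap x y * w) < wordLength w := by
  obtain ⟨ω, h, hl⟩ := exists_isReducedWordFor w
  obtain ⟨ω', h', hl'⟩ := h.1.exchange hxy hw
  have := h'.wordLength_le
  omega

/-- If `w⁻¹` ascended at the first letter, `(s * w)⁻¹` would descend there, and the exchange
property would make `w` shorter than the tail. -/
theorem IsReducedWordFor.of_cons {m : ℕ} {ω : List (Perm (Fin m))} {w s : Perm (Fin m)}
    (h : IsReducedWordFor (s :: ω) w) :
    IsReducedWordFor ω (s * w) ∧ ∃ a b : Fin m, (a : ℕ) + 1 = b ∧ s = swap a b ∧ w⁻¹ b < w⁻¹ a := by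
  obtain ⟨a, b, hab, rfl⟩ := h.1.1 s (by simp)
  have hlt : a < b := Fin.lt_def.2 (by omega)
  have hp := h.1.2
  rw [List.prod_cons] at hp
  have hω : IsReducedWordFor ω (swap a b * w) := by
    refine ⟨⟨fun s hs => h.1.1 s (by simp [hs]), by rw [← hp, swap_mul_self_mul]⟩, fun ω' h' => ?_⟩
    have := h.2 _ (h'.cons ⟨a, b, hab, rfl⟩ |> (swap_mul_self_mul a b w ▸ ·))
    simpa using this
  refine ⟨hω, a, b, hab, rfl, ?_⟩
  by_contra hc
  have h₁ : (swap a b * w)⁻¹ b < (swap a b * w)⁻¹ a := by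
    have : w⁻¹ a ≠ w⁻¹ b := fun e => hlt.ne (w⁻¹.injective e)
    simpa [mul_inv_rev] using lt_of_le_of_ne (not_lt.1 hc) this
  have h₂ := wordLength_lt_of_inversion hlt h₁
  rw [swap_mul_self_mul, ← h.length_eq, ← hω.length_eq, List.length_cons] at h₂
  omega

/-- The first letter is a descent of `w⁻¹`, so removing it goes down; this settles a dropped letter.
A kept letter multiplies both sides, by `PrefixLE.mul_swap_mul_swap`. -/
theorem prefixLE_of_sublist {m : ℕ} {ω ω' : List (Perm (Fin m))} {w : Perm (Fin m)}
    (h : IsReducedWordFor ω w) (hs : ω'.Sublist ω) : PrefixLE ω'.prod⁻¹ w⁻¹ := by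
  induction ω generalizing ω' w with
  | nil =>
    rw [List.sublist_nil.1 hs, ← h.1.2]
    exact PrefixLE.refl _
  | cons r ω ih =>
    obtain ⟨hω, a, b, hab, rfl, hlt⟩ := h.of_cons
    have hab' : a < b := Fin.lt_def.2 (by omega)
    have hdown : PrefixLE (w⁻¹ * swap a b) w⁻¹ := prefixLE_mul_swap hab' hlt
    have hinv : (swap a b * w)⁻¹ = w⁻¹ * swap a b := by rw [mul_inv_rev, swap_inv]
    cases hs with
    | cons _ hs => exact (hinv ▸ ih hω hs).trans hdown
    | cons_cons _ hs =>
      have := (hinv ▸ ih hω hs).mul_swap_mul_swap hab (by simpa using hlt)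
      rwa [mul_swap_mul_self, ← swap_inv, ← mul_inv_rev, ← List.prod_cons] at this

/-- Every reduced word serves. The first letter is skipped if `u⁻¹` ascends there and used if it
descends; the lifting property brings both cases below the tail. -/
theorem exists_sublist_of_prefixLE {m : ℕ} {ω : List (Perm (Fin m))} {u w : Perm (Fin m)}
    (h : IsReducedWordFor ω w) (hle : PrefixLE u⁻¹ w⁻¹) : ∃ ω' : List (Perm (Fin m)), ω'.Sublist ω ∧ ω'.prod = u := by
  induction ω generalizing u w with
  | nil =>
    refine ⟨[], List.Sublist.refl _, ?_⟩
    have hw : w = 1 := h.1.2.symm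
    subst hw
    -- Anything else below the identity would give the identity an inversion.
    by_contra hne
    obtain ⟨i, j, hij, -, -, hlt, -⟩ := hle.exists_swap (by
      rw [Ne, inv_inj]
      exact Ne.symm hne)
    simp at hlt
    exact hij.asymm hlt
  | cons r ω ih =>
    obtain ⟨hω, a, b, hab, rfl, hlt⟩ := h.of_cons
    have hab' : a < b := Fin.lt_def.2 (by omega)
    have hinv : ∀ w : Perm (Fin m), (swap a b * w)⁻¹ = w⁻¹ * swap a b := fun w => by
      rw [mul_inv_rev, swap_inv]
    rcases lt_or_gt_of_ne (fun e => hab'.ne (u⁻¹.injective e)) with hu | hu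
    · obtain ⟨ω', hs, hp⟩ := ih hω (hinv w ▸ hle.le_mul_swap hab hlt hu)
      exact ⟨ω', hs.cons _, hp⟩
    · have hdown := (prefixLE_mul_swap hab' hu).trans hle
      obtain ⟨ω', hs, hp⟩ := ih (u := swap a b * u) hω (by
        rw [hinv, hinv]
        exact hdown.le_mul_swap hab hlt (by simpa using hu))
      exact ⟨swap a b :: ω', hs.cons_cons _, by rw [List.prod_cons, hp, swap_mul_self_mul]⟩

/-- The subword order is the comparison of prefix counts of inverses. -/
theorem bruhatLE_iff {m : ℕ} {u w : Perm (Fin m)} : BruhatLE u w ↔ PrefixLE u⁻¹ w⁻¹ := by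
  constructor
  · rintro ⟨ω, hω, ω', hs, rfl⟩
    exact prefixLE_of_sublist hω hs
  · intro h
    obtain ⟨ω, hω, -⟩ := exists_isReducedWordFor w
    exact ⟨ω, hω, exists_sublist_of_prefixLE hω h⟩

theorem bruhat_lt_iff {m : ℕ} {u w : Perm (Fin m)} : u < w ↔ PrefixLE u⁻¹ w⁻¹ ∧ u ≠ w :=
  and_congr_left' bruhatLE_iff

theorem bruhat_lt_trans {m : ℕ} {u v w : Perm (Fin m)} (h₁ : u < v) (h₂ : v < w) : u < w := by
  rw [bruhat_lt_iff] at *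
  refine ⟨h₁.1.trans h₂.1, ?_⟩
  rintro rfl
  exact h₁.2 (inv_injective (h₁.1.antisymm h₂.1))

theorem wordLength_lt {m : ℕ} {u w : Perm (Fin m)} (h : u < w) : wordLength u < wordLength w := by
  obtain ⟨⟨ω, hω, ω', hs, rfl⟩, hne⟩ := h
  have hw : IsWordFor ω' ω'.prod := ⟨fun s hm => hω.1.1 s (hs.mem hm), rfl⟩
  rw [← hω.length_eq]
  refine lt_of_le_of_lt hw.wordLength_le (lt_of_le_of_ne hs.length_le fun hl => hne ?_)
  rw [hs.eq_of_length hl, hω.1.2]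

/-! ### Covering pairs -/

/-- `(x, y)` is an inversion of `g`, and no position in between has a value in between. -/
def IsTightInversion {m : ℕ} (g : Perm (Fin m)) (x y : Fin m) : Prop :=
  x < y ∧ g y < g x ∧ ∀ z, x < z → z < y → ¬ (g y < g z ∧ g z < g x)

/-- With `z = x + 1`, write `(x y) = (x z)(z y)(x z)`. By induction the middle factor adds at most
one. By tightness `u⁻¹ z` lies below `u⁻¹ x` or above `u⁻¹ y`; accordingly the factor `(x z)`
applied first or the one applied last shortens, and the other adds at most one. -/
theorem wordLength_le_of_tight {m : ℕ} {u : Perm (Fin m)} {x y : Fin m} (hxy : x < y)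
    (hu : u⁻¹ x < u⁻¹ y) (hno : ∀ z, x < z → z < y → ¬ (u⁻¹ x < u⁻¹ z ∧ u⁻¹ z < u⁻¹ y)) :
    wordLength (swap x y * u) ≤ wordLength u + 1 := by
  obtain ⟨n, hn⟩ : ∃ n : ℕ, (y : ℕ) = x + 1 + n := ⟨y - (x + 1), by
    have := Fin.lt_def.1 hxy
    omega⟩
  induction n generalizing u x with
  | zero => exact wordLength_swap_mul_le u (by omega)
  | succ n ih =>
    have hz : (x : ℕ) + 1 < m := by omega
    obtain ⟨z, hxz⟩ : ∃ z : Fin m, (x : ℕ) + 1 = z := ⟨⟨x + 1, hz⟩, rfl⟩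
    have hxz' : x < z := Fin.lt_def.2 (by omega)
    have hzy : z < y := Fin.lt_def.2 (by omega)
    have hconj : swap x y * u = swap x z * (swap z y * (swap x z * u)) := by
      have : swap x z * swap z y * swap x z = swap x y := by
        rw [swap_comm x z, swap_comm z y]
        exact swap_mul_swap_mul_swap hzy.ne' hxy.ne'
      rw [← this]
      simp only [mul_assoc]
    have e₁ : (swap x z * u)⁻¹ z = u⁻¹ x := by simp [mul_inv_rev]
    have e₂ : (swap x z * u)⁻¹ x = u⁻¹ z := by simp [mul_inv_rev]
    have e₃ : ∀ k, k ≠ x → k ≠ z → (swap x z * u)⁻¹ k = u⁻¹ k := fun k h₁ h₂ => by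
      simp [mul_inv_rev, swap_apply_of_ne_of_ne h₁ h₂]
    have e₄ := e₃ y hxy.ne' hzy.ne'
    have hv := ih (u := swap x z * u) hzy (by rwa [e₁, e₄]) (fun k hk hky => by
      rw [e₁, e₄, e₃ k (hxz'.trans hk).ne' hk.ne']
      exact hno k (hxz'.trans hk) hky) (by omega)
    have hle := wordLength_swap_mul_le (swap z y * (swap x z * u)) hxz
    rw [← hconj] at hle
    rcases lt_or_gt_of_ne (fun e => hxz'.ne (u⁻¹.injective e)) with h | h
    · have h' : u⁻¹ y < u⁻¹ z := lt_of_le_of_ne (not_lt.1 fun hc => hno z hxz' hzy ⟨h, hc⟩)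
        (fun e => hzy.ne' (u⁻¹.injective e))
      have hlt := wordLength_lt_of_inversion (w := swap z y * (swap x z * u)) hxz' (by
        have i₁ : (swap z y * (swap x z * u))⁻¹ z = u⁻¹ y := by
          rw [mul_inv_rev, swap_inv, Perm.mul_apply, swap_apply_left, e₄]
        have i₂ : (swap z y * (swap x z * u))⁻¹ x = u⁻¹ z := by
          rw [mul_inv_rev, swap_inv, Perm.mul_apply, swap_apply_of_ne_of_ne hxz'.ne hxy.ne, e₂]
        rwa [i₁, i₂])
      rw [← hconj] at hlt
      have := wordLength_swap_mul_le u hxz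
      omega
    · have := wordLength_lt_of_inversion hxz' h
      omega

theorem inv_swap_mul {m : ℕ} (x y : Fin m) (w : Perm (Fin m)) :
    (swap x y * w)⁻¹ = w⁻¹ * swap x y := by rw [mul_inv_rev, swap_inv]

theorem swap_mul_lt {m : ℕ} {w : Perm (Fin m)} {x y : Fin m} (hxy : x < y)
    (hw : w⁻¹ y < w⁻¹ x) : swap x y * w < w := by
  refine bruhat_lt_iff.2 ⟨inv_swap_mul x y w ▸ prefixLE_mul_swap hxy hw, fun h => ?_⟩
  have := wordLength_lt_of_inversion hxy hw
  rw [h] at this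
  exact lt_irrefl _ this

theorem IsTightInversion.wordLength_eq {m : ℕ} {w : Perm (Fin m)} {x y : Fin m}
    (h : IsTightInversion w⁻¹ x y) : wordLength w = wordLength (swap x y * w) + 1 := by
  have h₁ := wordLength_lt_of_inversion h.1 h.2.1
  have h₂ := wordLength_le_of_tight (u := swap x y * w) h.1 (by simpa [inv_swap_mul] using h.2.1)
    (fun z hz hz' => by
      have := h.2.2 z hz hz'
      simpa [inv_swap_mul, swap_apply_of_ne_of_ne hz.ne' hz'.ne] using this)
  rw [swap_mul_self_mul] at h₂
  omega

/-- Strict relations raise the length, and here it differs by one, so nothing fits in between. -/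
theorem IsTightInversion.covBy {m : ℕ} {w : Perm (Fin m)} {x y : Fin m}
    (h : IsTightInversion w⁻¹ x y) : swap x y * w ⋖ w := by
  refine ⟨swap_mul_lt h.1 h.2.1, fun v h₁ h₂ => ?_⟩
  have := wordLength_lt h₁
  have := wordLength_lt h₂
  have := h.wordLength_eq
  omega

/-- The smallest label, in the dictionary order, of a coatom of the interval from `u` to `w`. -/
theorem exists_greedy {m : ℕ} {u w : Perm (Fin m)} (h : u < w) :
    ∃ i j : Fin m, IsTightInversion w⁻¹ i j ∧ (∀ k < i, u⁻¹ k = w⁻¹ k) ∧ u⁻¹ i ≤ w⁻¹ j ∧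
      (∀ k, i < k → k < j → ¬ (u⁻¹ i ≤ w⁻¹ k ∧ w⁻¹ k < w⁻¹ i)) ∧
      (u = swap i j * w ∨ u < swap i j * w) := by
  rw [bruhat_lt_iff] at h
  obtain ⟨i, j, hij, hagree, h₁, h₂, hno, hle⟩ := h.1.exists_swap (inv_injective.ne h.2)
  refine ⟨i, j, ⟨hij, h₂, fun z hz hz' hc => hno z hz hz' ⟨h₁.trans hc.1.le, hc.2⟩⟩, hagree, h₁,
    hno, ?_⟩
  rw [bruhat_lt_iff, inv_swap_mul]
  tauto

/-- The greedy exchange lies weakly above `u` and strictly below `w`, so in a cover it is `u`. -/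
theorem exists_tightInversion_of_covBy {m : ℕ} {u w : Perm (Fin m)} (h : u ⋖ w) :
    ∃ i j : Fin m, IsTightInversion w⁻¹ i j ∧ u = swap i j * w := by
  obtain ⟨i, j, ht, -, -, -, hu⟩ := exists_greedy h.1
  exact ⟨i, j, ht, hu.resolve_right fun hc => h.2 hc (swap_mul_lt ht.1 ht.2.1)⟩

theorem wordLength_covBy {m : ℕ} {u w : Perm (Fin m)} (h : u ⋖ w) :
    wordLength w = wordLength u + 1 := by
  obtain ⟨i, j, ht, rfl⟩ := exists_tightInversion_of_covBy h
  exact ht.wordLength_eq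

/-! ### Saturated chains -/

namespace SaturatedChain

variable {P Q : Type*} [LT P]

/-- Extend a saturated chain at the top. -/
def snoc {x y z : P} : SaturatedChain x y → y ⋖ z → SaturatedChain x z
  | .nil _, h => .cons h (.nil _)
  | .cons h' c, h => .cons h' (c.snoc h)

theorem labels_snoc (lam : EdgeLabeling P Q) {x y z : P} (c : SaturatedChain x y) (h : y ⋖ z) :
    (c.snoc h).labels lam = c.labels lam ++ [lam y z h] := by
  induction c with
  | nil x => rfl
  | cons h' c ih => simp [snoc, labels, ih]

theorem exists_cons_eq_snoc {x y z : P} (h : x ⋖ y) (c : SaturatedChain y z) :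
    ∃ (w : P) (c' : SaturatedChain x w) (h' : w ⋖ z), cons h c = c'.snoc h' := by
  induction c generalizing x with
  | nil y => exact ⟨x, .nil x, h, rfl⟩
  | cons h' c ih =>
    obtain ⟨w, c', h'', e⟩ := ih h'
    exact ⟨w, .cons h c', h'', by rw [e]; rfl⟩

/-- If the labels of the upper covers of each element are distinct, a chain is determined by its
label word. -/
theorem eq_of_labels_eq {lam : EdgeLabeling P Q}
    (hinj : ∀ x y z (h : x ⋖ y) (h' : x ⋖ z), lam x y h = lam x z h' → y = z)
    {x y : P} {c d : SaturatedChain x y} (h : c.labels lam = d.labels lam) : c = d := by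
  induction c with
  | nil x =>
    cases d with
    | nil => rfl
    | cons h' d => simp [labels] at h
  | cons h' c ih =>
    cases d with
    | nil => simp [labels] at h
    | cons h'' d =>
      simp only [labels, List.cons.injEq] at h
      obtain rfl := hinj _ _ _ _ _ h.1
      rw [ih h.2]

theorem rank_eq {r : P → ℕ} (hr : ∀ x y : P, x ⋖ y → r y = r x + 1) (lam : EdgeLabeling P Q)
    {x y : P} (c : SaturatedChain x y) : r y = r x + (c.labels lam).length := by
  induction c with
  | nil x => rfl
  | cons h c ih =>
    rw [ih, hr _ _ h, labels, List.length_cons]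
    omega

variable [LinearOrder Q]

theorem isRising_cons_iff {lam : EdgeLabeling P Q} {x y z : P} {h : x ⋖ y}
    {c : SaturatedChain y z} :
    (cons h c).IsRising lam ↔ (∀ l ∈ c.labels lam, lam x y h ≤ l) ∧ c.IsRising lam :=
  List.pairwise_cons

theorem isRising_snoc_iff {lam : EdgeLabeling P Q} {x y z : P} {c : SaturatedChain x y}
    {h : y ⋖ z} :
    (c.snoc h).IsRising lam ↔ c.IsRising lam ∧ ∀ l ∈ c.labels lam, l ≤ lam y z h := by
  simp [IsRising, labels_snoc, List.pairwise_append]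

theorem isRising_cons_cons {lam : EdgeLabeling P Q} {x y z w : P} {h : x ⋖ y} {h' : y ⋖ z}
    {c : SaturatedChain z w} (hc : (cons h' c).IsRising lam) (hle : lam x y h ≤ lam y z h') :
    (cons h (cons h' c)).IsRising lam := by
  refine isRising_cons_iff.2 ⟨fun l hl => ?_, hc⟩
  rcases List.mem_cons.1 hl with rfl | hl
  · exact hle
  · exact hle.trans ((isRising_cons_iff.1 hc).1 l hl)

end SaturatedChain

/-- An edge labeling of a graded order for which each interval has a unique rising chain is an
EL-labeling as soon as the rising chain is lexicographically first in intervals of rank two: the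
rising chain then comes before every other chain. -/
theorem lexLT_of_rank_two {P Q : Type*} [LT P] [LinearOrder Q] [WellFoundedLT Q]
    {lam : EdgeLabeling P Q}
    (hinj : ∀ x y z (h : x ⋖ y) (h' : x ⋖ z), lam x y h = lam x z h' → y = z)
    {r : P → ℕ} (hr : ∀ x y : P, x ⋖ y → r y = r x + 1)
    (hex : ∀ x y : P, SaturatedChain x y → ∃ c : SaturatedChain x y, c.IsRising lam)
    (huniq : ∀ (x y : P) (c d : SaturatedChain x y), c.IsRising lam → d.IsRising lam → c = d)
    (htwo : ∀ (x a b y : P) (h₁ : x ⋖ a) (h₂ : a ⋖ y) (h₃ : x ⋖ b) (h₄ : b ⋖ y),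
      lam x a h₁ ≤ lam a y h₂ → lam b y h₄ < lam x b h₃ → lam x a h₁ < lam x b h₃)
    {x y : P} (c d : SaturatedChain x y) (hc : c.IsRising lam) (hd : d ≠ c) : c.LexLT lam d := by
  have first : ∀ (x a y : P) (h₀ : x ⋖ a) (c : SaturatedChain a y),
      (SaturatedChain.cons h₀ c).IsRising lam → ∀ (q : Q) (b : P) (h : x ⋖ b),
      lam x b h = q → SaturatedChain b y → lam x a h₀ ≤ q := by
    intro x a y h₀ c hc q
    -- Induction on the first label of the competing chain, whose remainder may be replaced by a
    -- rising one.
    induction q using WellFoundedLT.induction with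
    | ind q ih =>
      rintro b h rfl d
      obtain ⟨e, he⟩ := hex b y d
      cases e with
      | nil =>
        have := huniq _ _ _ (.cons h (.nil _)) hc (List.pairwise_singleton _ _)
        cases this
        exact le_rfl
      | @cons _ b' _ h' e =>
        rcases le_or_gt (lam x b h) (lam b b' h') with hle | hlt
        · have := huniq _ _ _ _ hc (SaturatedChain.isRising_cons_cons he hle)
          cases this
          exact le_rfl
        -- A descent at the bottom: the rising chain of this rank two interval starts with a smaller
        -- label. The rank forces `f` to have exactly two edges.
        · obtain ⟨f, hf⟩ := hex x b' (.cons h (.cons h' (.nil b')))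
          have hrank := f.rank_eq hr lam
          have h₁ := hr _ _ h
          have h₂ := hr _ _ h'
          cases f with
          | nil => omega
          | @cons _ a' _ h₃ f =>
            have h₄ := hr _ _ h₃
            cases f with
            | nil => omega
            | @cons _ a'' _ h₅ f =>
              have hnil := f.rank_eq hr lam
              have h₆ := hr _ _ h₅
              cases f with
              | cons h₇ f =>
                simp only [SaturatedChain.labels, List.length_cons] at hrank
                omega
              | nil =>
                have hlt' := htwo x a' b b' h₃ h₅ h h' (by
                  exact (SaturatedChain.isRising_cons_iff.1 hf).1 _ (by simp [SaturatedChain.labels]))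
                  hlt
                exact (ih _ hlt' a' h₃ rfl (.cons h₅ e)).trans hlt'.le
  induction d with
  | nil x =>
    have := c.rank_eq hr lam
    exact absurd (SaturatedChain.eq_of_labels_eq hinj
      (by rw [List.length_eq_zero_iff.1 (by omega : (c.labels lam).length = 0)]; rfl)) hd
  | @cons x b y h d ih =>
    have hrank := (SaturatedChain.cons h d).rank_eq hr lam
    cases c with
    | nil =>
      simp [SaturatedChain.labels] at hrank
    | @cons _ a _ h₀ c =>
      rcases (first x a y h₀ c hc _ b h rfl d).lt_or_eq with hlt | heq
      · exact List.Lex.rel hlt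
      · obtain rfl := hinj _ _ _ _ _ heq
        exact List.Lex.cons (ih c (SaturatedChain.isRising_cons_iff.1 hc).2
          (fun e => hd (by rw [e])))

/-! ### The inverse standard labeling -/

theorem Transposition.le_iff {m : ℕ} {s t : Transposition m} :
    s ≤ t ↔ s.i < t.i ∨ s.i = t.i ∧ s.j ≤ t.j :=
  Prod.Lex.toLex_le_toLex

theorem Transposition.lt_iff {m : ℕ} {s t : Transposition m} :
    s < t ↔ s.i < t.i ∨ s.i = t.i ∧ s.j < t.j :=
  Prod.Lex.toLex_lt_toLex

instance Transposition.instFinite (m : ℕ) : Finite (Transposition m) :=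
  Finite.of_injective _ (Transposition.toLex_injective m)

theorem Transposition.toPerm_injective (m : ℕ) :
    Function.Injective (Transposition.toPerm : Transposition m → Perm (Fin m)) := by
  rintro ⟨i, j, hij⟩ ⟨k, l, hkl⟩ h
  have h₁ := DFunLike.congr_fun h i
  have h₂ := DFunLike.congr_fun h j
  simp only [Transposition.toPerm, swap_apply_def] at h₁ h₂
  ext <;> grind

/-- In the dictionary order, two factorizations of a permutation into two transpositions are not
nested. -/
theorem Transposition.not_nested {m : ℕ} {t s s' t' : Transposition m} (h₁ : t < s) (h₂ : s < s')
    (h₃ : s' < t') : s.toPerm * t.toPerm ≠ s'.toPerm * t'.toPerm := by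
  intro h
  obtain ⟨a, b, hab⟩ := t
  obtain ⟨c, d, hcd⟩ := s
  obtain ⟨c', d', hcd'⟩ := s'
  obtain ⟨a', b', hab'⟩ := t'
  have h₁' := DFunLike.congr_fun h a
  -- If `a < c`, the left product moves `a` and the right one fixes it. If `a = c`, the left product
  -- sends `a` to `b`, the right one to `a` or to a point beyond `b`.
  simp only [Transposition.lt_iff, Transposition.toPerm, Perm.mul_apply, swap_apply_def] at *
  grind

theorem IsInverseStandardLabeling.eq_toDual {m : ℕ}
    {lam : EdgeLabeling (Perm (Fin m)) (Transposition m)ᵒᵈ} (hlam : IsInverseStandardLabeling lam)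
    {σ τ : Perm (Fin m)} (h : σ ⋖ τ) {t : Transposition m} (ht : σ = t.toPerm * τ) :
    lam σ τ h = OrderDual.toDual t := by
  have := hlam σ τ h
  exact congrArg OrderDual.toDual
    (Transposition.toPerm_injective m (mul_right_cancel (this.symm.trans ht)))

theorem exists_transposition_of_covBy {m : ℕ} {σ τ : Perm (Fin m)} (h : σ ⋖ τ) :
    ∃ t : Transposition m, IsTightInversion τ⁻¹ t.i t.j ∧ σ = t.toPerm * τ := by
  obtain ⟨i, j, ht, e⟩ := exists_tightInversion_of_covBy h
  exact ⟨⟨i, j, ht.1⟩, ht, e⟩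

theorem IsInverseStandardLabeling.tight {m : ℕ}
    {lam : EdgeLabeling (Perm (Fin m)) (Transposition m)ᵒᵈ} (hlam : IsInverseStandardLabeling lam)
    {σ τ : Perm (Fin m)} (h : σ ⋖ τ) :
    IsTightInversion τ⁻¹ (OrderDual.ofDual (lam σ τ h)).i (OrderDual.ofDual (lam σ τ h)).j := by
  obtain ⟨t, ht, e⟩ := exists_transposition_of_covBy h
  rw [hlam.eq_toDual h e]
  exact ht

theorem existsUnique_inverseStandardLabeling (m : ℕ) :
    ∃! lam : EdgeLabeling (Perm (Fin m)) (Transposition m)ᵒᵈ, IsInverseStandardLabeling lam := by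
  choose t ht using fun (σ τ : Perm (Fin m)) (h : σ ⋖ τ) => exists_transposition_of_covBy h
  refine ⟨fun σ τ h => OrderDual.toDual (t σ τ h), fun σ τ h => (ht σ τ h).2, fun lam hlam => ?_⟩
  funext σ τ h
  exact hlam.eq_toDual h (ht σ τ h).2

theorem Transposition.toPerm_inv_mul_apply {m : ℕ} {σ τ : Perm (Fin m)} {t : Transposition m}
    (h : σ = t.toPerm * τ) (k : Fin m) : σ⁻¹ k = τ⁻¹ (swap t.i t.j k) := by
  rw [h, Transposition.toPerm, inv_swap_mul, Perm.mul_apply]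

theorem SaturatedChain.eq_or_lt {m : ℕ} {x y : Perm (Fin m)} (c : SaturatedChain x y) :
    x = y ∨ x < y := by
  induction c with
  | nil x => exact Or.inl rfl
  | cons h c ih =>
    rcases ih with rfl | h'
    · exact Or.inr h.1
    · exact Or.inr (bruhat_lt_trans h.1 h')

theorem SaturatedChain.prefixLE {m : ℕ} {x y : Perm (Fin m)} (c : SaturatedChain x y) :
    PrefixLE x⁻¹ y⁻¹ := by
  rcases c.eq_or_lt with rfl | h
  · exact PrefixLE.refl _
  · exact (bruhat_lt_iff.1 h).1

/-! ### Rising chains: existence, uniqueness and intervals of rank two -/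

namespace IsInverseStandardLabeling

variable {m : ℕ} {lam : EdgeLabeling (Perm (Fin m)) (Transposition m)ᵒᵈ}
  (hlam : IsInverseStandardLabeling lam)

include hlam

theorem upper_injective (x y z : Perm (Fin m)) (h : x ⋖ y) (h' : x ⋖ z)
    (e : lam x y h = lam x z h') : y = z := by
  have h₁ := hlam x y h
  rw [e] at h₁
  exact mul_left_cancel (h₁.symm.trans (hlam x z h'))

/-- Greedy descent from `y`. The bound `(i, j)` on all labels is carried through the induction so
that the greedy label can be appended on top of the chain below it. -/
theorem exists_rising {x y : Perm (Fin m)} (hxy : x = y ∨ x < y) {i j : Fin m} (hij : i < j)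
    (hagree : ∀ k < i, x⁻¹ k = y⁻¹ k)
    (hno : ∀ k, i < k → k < j → ¬ (x⁻¹ i ≤ y⁻¹ k ∧ y⁻¹ k < y⁻¹ i)) :
    ∃ c : SaturatedChain x y, c.IsRising lam ∧
      ∀ l ∈ c.labels lam, (⟨i, j, hij⟩ : Transposition m) ≤ OrderDual.ofDual l := by
  induction hn : wordLength y using Nat.strong_induction_on generalizing y i j with
  | _ n ih =>
    rcases hxy with rfl | hxy
    · exact ⟨.nil x, List.Pairwise.nil, by simp [SaturatedChain.labels]⟩
    obtain ⟨i₀, j₀, ht, hagree₀, hle₀, hno₀, hx⟩ := exists_greedy hxy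
    have hcov := ht.covBy
    have happ := Transposition.toPerm_inv_mul_apply (σ := swap i₀ j₀ * y) (τ := y)
      (t := ⟨i₀, j₀, ht.1⟩) rfl
    simp only at happ
    have hlt : wordLength (swap i₀ j₀ * y) < n := hn ▸ wordLength_lt hcov.1
    -- The exchange lowers the value at `i₀`, so the window of admissible values shrinks, and the
    -- positions between `i₀` and `j₀` stay excluded.
    obtain ⟨c, hc, hl⟩ := ih _ hlt hx ht.1 (fun k hk => by
        rw [happ, swap_apply_of_ne_of_ne hk.ne (hk.trans ht.1).ne]
        exact hagree₀ k hk) (fun k hk hk' hc => by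
        rw [happ, happ, swap_apply_of_ne_of_ne hk.ne' hk'.ne, swap_apply_left] at hc
        exact hno₀ k hk hk' ⟨hc.1, hc.2.trans ht.2.1⟩) rfl
    have hlab : lam _ _ hcov = OrderDual.toDual ⟨i₀, j₀, ht.1⟩ := hlam.eq_toDual hcov rfl
    have hmin : (⟨i, j, hij⟩ : Transposition m) ≤ ⟨i₀, j₀, ht.1⟩ := by
      rw [Transposition.le_iff]
      rcases lt_trichotomy i i₀ with h | rfl | h
      · exact Or.inl h
      · exact Or.inr ⟨rfl, not_lt.1 fun h => hno j₀ ht.1 h ⟨hle₀, ht.2.1⟩⟩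
      · exact absurd (hle₀.trans_lt ht.2.1) (hagree i₀ h).not_lt
    refine ⟨c.snoc hcov, SaturatedChain.isRising_snoc_iff.2 ⟨hc, fun l h => ?_⟩, fun l h => ?_⟩
    · rw [hlab]
      exact hl l h
    · rw [SaturatedChain.labels_snoc, List.mem_append, List.mem_singleton] at h
      rcases h with h | rfl
      · exact hmin.trans (hl l h)
      · rw [hlab]
        exact hmin

theorem exists_rising_of_chain (x y : Perm (Fin m)) (d : SaturatedChain x y) :
    ∃ c : SaturatedChain x y, c.IsRising lam := by
  rcases d.eq_or_lt with rfl | hxy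
  · exact ⟨.nil x, List.Pairwise.nil⟩
  obtain ⟨i, j, ht, hagree, -, hno, -⟩ := exists_greedy hxy
  obtain ⟨c, hc, -⟩ := hlam.exists_rising (Or.inr hxy) ht.1 hagree hno
  exact ⟨c, hc⟩

theorem apply_eq_of_forall_lt {x y : Perm (Fin m)} (c : SaturatedChain x y) {k : Fin m}
    (h : ∀ l ∈ c.labels lam, k < (OrderDual.ofDual l).i) : x⁻¹ k = y⁻¹ k := by
  induction c with
  | nil x => rfl
  | @cons x y z hc c ih =>
    have hk := h _ (List.mem_cons_self ..)
    rw [Transposition.toPerm_inv_mul_apply (hlam x y hc), swap_apply_of_ne_of_ne hk.ne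
      (hk.trans (Transposition.lt _)).ne]
    exact ih fun l hl => h l (List.mem_cons_of_mem _ hl)

/-- Along a rising chain whose labels are at least `(i, b)`, the value in position `i` cannot jump
over the value in a position `j` with `i < j < b`. -/
theorem lt_of_rising {x z : Perm (Fin m)} (c : SaturatedChain x z) (hc : c.IsRising lam)
    {i j b : Fin m} (hij : i < j) (hjb : j < b)
    (hl : ∀ l ∈ c.labels lam,
      (⟨i, b, hij.trans hjb⟩ : Transposition m) ≤ OrderDual.ofDual l) (h : z⁻¹ j < z⁻¹ i) :
    z⁻¹ j < x⁻¹ i ∧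
      ((∀ l ∈ c.labels lam, (OrderDual.ofDual l).i = i) → x⁻¹ j = z⁻¹ j) := by
  induction c with
  | nil x => exact ⟨h, fun _ => rfl⟩
  | @cons x y z hxy c ih =>
    have hc' := SaturatedChain.isRising_cons_iff.1 hc
    obtain ⟨ih₁, ih₂⟩ := ih hc'.2 (fun l h => hl l (List.mem_cons_of_mem _ h)) h
    have ht := hlam.tight hxy
    have happ := Transposition.toPerm_inv_mul_apply (hlam x y hxy)
    have hfirst := hl _ (List.mem_cons_self ..)
    rcases Transposition.le_iff.1 hfirst with hi | ⟨hi, hb⟩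
    · refine ⟨?_, fun hall => absurd (hall _ (List.mem_cons_self ..)) hi.ne'⟩
      rwa [happ, swap_apply_of_ne_of_ne hi.ne (hi.trans (Transposition.lt _)).ne]
    · simp only at hi hb
      -- In the dictionary order the labels above lie between `(i, b)` and the bottom label, which
      -- also starts with `i`.
      have hall : ∀ l ∈ c.labels lam, (OrderDual.ofDual l).i = i := fun l hl' => by
        have h₁ := Transposition.le_iff.1 (hl l (List.mem_cons_of_mem _ hl'))
        have h₂ := Transposition.le_iff.1 (OrderDual.ofDual_le_ofDual.2 (hc'.1 l hl'))
        simp only at h₁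
        rw [← hi] at h₂
        rcases h₂ with h₂ | h₂
        · rcases h₁ with h₁ | h₁
          · exact absurd h₁ h₂.asymm
          · exact h₁.1.symm
        · exact h₂.1
      have hj := hjb.trans_le hb
      have hyj := ih₂ hall
      rw [← hi] at ht happ
      have hxi : x⁻¹ i = y⁻¹ (OrderDual.ofDual (lam x y hxy)).j := by rw [happ, swap_apply_left]
      refine ⟨?_, fun _ => by rw [happ, swap_apply_of_ne_of_ne hij.ne' hj.ne, hyj]⟩
      rw [hxi, ← hyj]
      rw [← hyj] at ih₁
      -- Tightness keeps `y⁻¹ j` from lying between the new and the old value at `i`; being below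
      -- the old one, it is below the new one.
      exact lt_of_le_of_ne (not_lt.1 fun hlt => ht.2.2 j hij hj ⟨hlt, ih₁⟩)
        fun e => hj.ne (y⁻¹.injective e)

/-- The top label `(a, b)` is the smallest in the dictionary order. If `a > i`, position `i` would
never change; if `a < i`, the agreement before `i` would break. The choice of `j` excludes `b < j`.
If `b > j`, the value at `i` could never come down past `z⁻¹ j`, by `lt_of_rising`, although `x⁻¹ i
≤ z⁻¹ j`. -/
theorem last_eq {x y z : Perm (Fin m)} (c : SaturatedChain x y) (h : y ⋖ z)
    (hc : (c.snoc h).IsRising lam) {i j : Fin m} (hij : i < j)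
    (hagree : ∀ k < i, x⁻¹ k = z⁻¹ k) (hle : x⁻¹ i ≤ z⁻¹ j) (hlt : z⁻¹ j < z⁻¹ i)
    (hno : ∀ k, i < k → k < j → ¬ (x⁻¹ i ≤ z⁻¹ k ∧ z⁻¹ k < z⁻¹ i)) :
    lam y z h = OrderDual.toDual ⟨i, j, hij⟩ := by
  have ht := hlam.tight h
  have happ := Transposition.toPerm_inv_mul_apply (hlam y z h)
  have hc' := SaturatedChain.isRising_snoc_iff.1 hc
  have hmin : ∀ l ∈ c.labels lam, OrderDual.ofDual (lam y z h) ≤ OrderDual.ofDual l := hc'.2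
  obtain ⟨⟨a, b, hab⟩, hlab⟩ : ∃ t : Transposition m, lam y z h = OrderDual.toDual t := ⟨_, rfl⟩
  rw [hlab] at ht happ hmin ⊢
  simp only [OrderDual.ofDual_toDual] at ht happ hmin
  have hyz : PrefixLE y⁻¹ z⁻¹ := (bruhat_lt_iff.1 h.1).1
  have hyagree := c.prefixLE.agree hyz hagree
  have hai : a ≤ i := by
    by_contra! hc
    have h₁ : x⁻¹ i = y⁻¹ i := hlam.apply_eq_of_forall_lt c fun l hl => by
      rcases Transposition.le_iff.1 (hmin l hl) with h | h
      · exact hc.trans h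
      · exact hc.trans_eq h.1
    rw [happ, swap_apply_of_ne_of_ne hc.ne (hc.trans hab).ne] at h₁
    exact (hle.trans_lt hlt).ne h₁
  have hya : y⁻¹ a = z⁻¹ b := by rw [happ, swap_apply_left]
  obtain rfl : a = i := hai.eq_of_not_lt fun hlt' => by
    have := (hyagree a hlt').trans (hagree a hlt')
    rw [hya] at this
    exact hab.ne' (z⁻¹.injective this)
  have hxb : x⁻¹ a ≤ z⁻¹ b := hya ▸ c.prefixLE.apply_le fun k hk => (hyagree k hk).symm
  have hjb : j ≤ b := not_lt.1 fun hbj => hno b hab hbj ⟨hxb, ht.2.1⟩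
  rcases hjb.eq_or_lt with rfl | hjb
  · rfl
  · have hyj : y⁻¹ j = z⁻¹ j := by rw [happ, swap_apply_of_ne_of_ne hij.ne' hjb.ne]
    have hjump : z⁻¹ j < z⁻¹ b := lt_of_le_of_ne
      (not_lt.1 fun h' => ht.2.2 j hij hjb ⟨h', hlt⟩) fun e => hjb.ne (z⁻¹.injective e)
    have := (hlam.lt_of_rising c hc'.1 hij hjb hmin (by rwa [hyj, hya])).1
    rw [hyj] at this
    exact absurd hle this.not_ge

/-- By `last_eq` both chains have the same top edge; remove it and induct on the length of `y`. -/
theorem rising_unique (x y : Perm (Fin m)) (c d : SaturatedChain x y) (hc : c.IsRising lam)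
    (hd : d.IsRising lam) : c = d := by
  induction hn : wordLength y using Nat.strong_induction_on generalizing y with
  | _ n ih =>
    rcases c.eq_or_lt with rfl | hxy
    · have h₁ := c.rank_eq (fun _ _ => wordLength_covBy) lam
      have h₂ := d.rank_eq (fun _ _ => wordLength_covBy) lam
      refine SaturatedChain.eq_of_labels_eq hlam.upper_injective ?_
      rw [List.length_eq_zero_iff.1 (by omega : (c.labels lam).length = 0),
        List.length_eq_zero_iff.1 (by omega : (d.labels lam).length = 0)]
    obtain ⟨i, j, ht, hagree, hle, hno, -⟩ := exists_greedy hxy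
    have snoc : ∀ c : SaturatedChain x y, ∃ (w : _) (c' : SaturatedChain x w) (h : w ⋖ y),
        c = c'.snoc h := by
      intro c
      cases c with
      | nil => exact absurd rfl hxy.2
      | cons h c => exact SaturatedChain.exists_cons_eq_snoc h c
    obtain ⟨v, c, h, rfl⟩ := snoc c
    obtain ⟨w, d, h', rfl⟩ := snoc d
    have e₁ := hlam.last_eq c h hc ht.1 hagree hle ht.2.1 hno
    have e₂ := hlam.last_eq d h' hd ht.1 hagree hle ht.2.1 hno
    obtain rfl : v = w := by rw [hlam v y h, hlam w y h', e₁, e₂]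
    rw [ih _ (hn ▸ wordLength_lt h.1) v c d (SaturatedChain.isRising_snoc_iff.1 hc).1
      (SaturatedChain.isRising_snoc_iff.1 hd).1 rfl]

/-- Both chains factor the same permutation. If the claim failed, the four labels would be nested;
coincidences among them cancel to contradict `hlt`. -/
theorem rising_first_of_rank_two (x a b y : Perm (Fin m)) (h₁ : x ⋖ a) (h₂ : a ⋖ y) (h₃ : x ⋖ b)
    (h₄ : b ⋖ y) (hle : lam x a h₁ ≤ lam a y h₂) (hlt : lam b y h₄ < lam x b h₃) :
    lam x a h₁ < lam x b h₃ := by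
  have e₁ := hlam x a h₁
  have e₂ := hlam a y h₂
  have e₃ := hlam x b h₃
  have e₄ := hlam b y h₄
  by_contra! hc
  have hprod : (OrderDual.ofDual (lam x a h₁)).toPerm * (OrderDual.ofDual (lam a y h₂)).toPerm =
      (OrderDual.ofDual (lam x b h₃)).toPerm * (OrderDual.ofDual (lam b y h₄)).toPerm := by
    refine mul_right_cancel (b := y) ?_
    rw [mul_assoc, mul_assoc, ← e₂, ← e₄, ← e₁, ← e₃]
  rcases hle.lt_or_eq with hlt₁ | heq₁
  · rcases hc.lt_or_eq with hlt₂ | heq₂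
    · exact Transposition.not_nested (OrderDual.ofDual_lt_ofDual.2 hlt₁)
        (OrderDual.ofDual_lt_ofDual.2 hlt₂) (OrderDual.ofDual_lt_ofDual.2 hlt) hprod
    · rw [heq₂] at hprod
      have := Transposition.toPerm_injective m (mul_left_cancel hprod)
      have : lam a y h₂ = lam b y h₄ := this
      rw [this, ← heq₂] at hlt₁
      exact hlt₁.asymm hlt
  · have hself : ∀ t : Transposition m, t.toPerm * t.toPerm = 1 := fun t => swap_mul_self _ _
    rw [heq₁, hself, ← hself (OrderDual.ofDual (lam x b h₃))] at hprod
    have := Transposition.toPerm_injective m (mul_left_cancel hprod)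
    exact hlt.ne' this

theorem isELLabeling : IsELLabeling lam where
  existsUnique_rising x y hxy := by
    obtain ⟨i, j, ht, hagree, -, hno, -⟩ := exists_greedy hxy
    obtain ⟨c, hc, -⟩ := hlam.exists_rising (Or.inr hxy) ht.1 hagree hno
    exact ⟨c, hc, fun d hd => hlam.rising_unique x y d c hd hc⟩
  lex_total x y _ c d hne := by
    by_contra! hc
    exact hne (SaturatedChain.eq_of_labels_eq hlam.upper_injective
      (Std.Trichotomous.trichotomous (r := List.Lex (· < ·)) _ _ hc.1 hc.2))
  rising_minimal _ _ _ c d hc hne :=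
    lexLT_of_rank_two hlam.upper_injective (fun _ _ => wordLength_covBy)
      hlam.exists_rising_of_chain hlam.rising_unique hlam.rising_first_of_rank_two c d hc hne

end IsInverseStandardLabeling

/-- The inverse standard labeling of the Bruhat order on the symmetric group exists, is unique,
and is an EL-labeling. -/
theorem theorem1 (m : ℕ) :
    (∃! lam : EdgeLabeling (Equiv.Perm (Fin m)) (Transposition m)ᵒᵈ,
      IsInverseStandardLabeling lam) ∧
    ∀ lam : EdgeLabeling (Equiv.Perm (Fin m)) (Transposition m)ᵒᵈ,
      IsInverseStandardLabeling lam → IsELLabeling lam :=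
  ⟨existsUnique_inverseStandardLabeling m, fun _ hlam => hlam.isELLabeling⟩
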